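/- Let $p$ be a prime and let $G$ be a pro-$p$-group, that is, a compact Hausdorff topological group whose identity has a neighbourhood basis of closed normal subgroups of $p$-power index. The complete nonabelian tensor square $G\widehat{\otimes}G$ is the pro-$p$-group topologically generated by symbols $x\widehat{\otimes}y$ ($x,y\in G$), depending continuously on $(x,y)$, subject to the relations $$xy\,\widehat{\otimes}\,z=(x^y\,\widehat{\otimes}\,z^y)(y\,\widehat{\otimes}\,z),\qquad y\,\widehat{\otimes}\,tz=(y\,\widehat{\otimes}\,z)(y^z\,\widehat{\otimes}\,t^z)\qquad(x,y,z,t\in G),$$ where $x^y=y^{-1}xy$. The complete nonabelian exterior square $G\widehat{\wedge}G$ is the quotient of $G\widehat{\otimes}G$ by the closed central subgroup topologically generated by all $x\widehat{\otimes}x$, and $x\widehat{\wedge}y$ denotes the image of $x\widehat{\otimes}y$. The complete exterior center is $\widehat{Z}(G)=\{g\in G : g\widehat{\wedge}y=1\text{ for all }y\in G\}$, and the exterior degree of $G$ is $$\widehat{\mathrm d}(G)=(\mu\times\mu)\big(\{(x,y)\in G\times G : x\widehat{\wedge}y=1\}\big),$$ where $\mu\times\mu$ denotes the normalized Haar measure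 of $G\times G$ (on its Borel sets). **Theorem.** Let $N$ be a closed normal subgroup of a pro-$p$-group $G$. Then $$\widehat{\mathrm d}(G)\le\widehat{\mathrm d}(G/N).$$ If moreover $N\le\widehat{Z}(G)$, then there is an isomorphism of topological groups $G\widehat{\wedge}G\to G/N\,\widehat{\wedge}\,G/N$ with $x\widehat{\wedge}y\mapsto xN\widehat{\wedge}yN$ for all $x,y\in G$, and $\widehat{\mathrm d}(G)=\widehat{\mathrm d}(G/N)$. -/

import Mathlib

open MeasureTheory Topology

namespace ProPExterior

noncomputable section

/-! ### Groups that are inverse limits of finite `p`-groups -/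

/-- `𝒫(G)`: the closed normal subgroups `N` of `G` such that `G / N` is a finite `p`-group
(i.e. such that `|G : N|` is a power of `p`; the index of a subgroup of infinite index is `0`
in Mathlib, which is not a power of a prime `p`). -/
def proPBase (p : ℕ) (G : Type*) [Group G] [TopologicalSpace G] : Set (Subgroup G) :=
  {N | N.Normal ∧ IsClosed (N : Set G) ∧ ∃ k : ℕ, N.index = p ^ k}

/-- A pro-`p`-group: a compact Hausdorff topological group whose identity has arbitrarily small
neighbourhoods in `𝒫(G)`. By compactness this says exactly that the canonical map
from `G` to the inverse limit of the finite `p`-groups `G / N`, `N ∈ 𝒫(G)`, is an isomorphism of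
topological groups. -/
structure IsProP (p : ℕ) (G : Type*) [Group G] [TopologicalSpace G] : Prop where
  isTopologicalGroup : IsTopologicalGroup G
  compactSpace : CompactSpace G
  t2Space : T2Space G
  exists_subset : ∀ U ∈ 𝓝 (1 : G), ∃ N ∈ proPBase p G, (N : Set G) ⊆ U

/-! ### The abstract nonabelian tensor square -/

section Abstract

variable (G : Type*) [Group G]

/-- The defining relators of the nonabelian tensor square, with `x ^ y = y⁻¹ x y`:
`xy ⊗ z = (x^y ⊗ z^y) (y ⊗ z)` and `y ⊗ tz = (y ⊗ z) (y^z ⊗ t^z)`. -/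
inductive TensorRel : FreeGroup (G × G) → Prop
  | left (x y z : G) : TensorRel
      (FreeGroup.of (x * y, z) *
        (FreeGroup.of (y⁻¹ * x * y, y⁻¹ * z * y) * FreeGroup.of (y, z))⁻¹)
  | right (y t z : G) : TensorRel
      (FreeGroup.of (y, t * z) *
        (FreeGroup.of (y, z) * FreeGroup.of (z⁻¹ * y * z, z⁻¹ * t * z))⁻¹)

/-- The abstract nonabelian tensor square `G ⊗ G`. -/
abbrev TensorSquare : Type _ := PresentedGroup {r | TensorRel G r}

/-- `G ⊗ G` is regarded as a discrete group, so that its quotients are discrete too. -/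
instance : TopologicalSpace (TensorSquare G) := ⊥

instance : DiscreteTopology (TensorSquare G) := ⟨rfl⟩

variable {G}

/-- The symbol `x ⊗ y` in the abstract tensor square. -/
def tmul (x y : G) : TensorSquare G := PresentedGroup.of (x, y)

theorem tmul_mul_left (x y z : G) :
    tmul (x * y) z = tmul (y⁻¹ * x * y) (y⁻¹ * z * y) * tmul y z := by
  have h := PresentedGroup.one_of_mem (rels := {r | TensorRel G r}) (TensorRel.left x y z)
  rw [map_mul, map_inv, map_mul, mul_inv_eq_one] at h
  exact h

theorem tmul_mul_right (y t z : G) :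
    tmul y (t * z) = tmul y z * tmul (z⁻¹ * y * z) (z⁻¹ * t * z) := by
  have h := PresentedGroup.one_of_mem (rels := {r | TensorRel G r}) (TensorRel.right y t z)
  rw [map_mul, map_inv, map_mul, mul_inv_eq_one] at h
  exact h

/-- The symbols `x ⊗ x` are central in `G ⊗ G`. -/
theorem tmul_self_mem_center (x : G) :
    tmul x x ∈ Subgroup.center (TensorSquare G) := by
  have key : ∀ u v : G, tmul u v * tmul x x = tmul x x * tmul u v := by
    intro u v
    obtain ⟨a, rfl⟩ : ∃ a, u = x⁻¹ * (x⁻¹ * a * x) * x := ⟨x * (x * u * x⁻¹) * x⁻¹, by group⟩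
    obtain ⟨c, rfl⟩ : ∃ c, v = x⁻¹ * (x⁻¹ * c * x) * x := ⟨x * (x * v * x⁻¹) * x⁻¹, by group⟩
    have hx : x⁻¹ * x * x = x := by group
    have hconj : ∀ d : G, x⁻¹ * (d * x) * x = (x⁻¹ * d * x) * x := fun d => by group
    have h1 := tmul_mul_left a x (c * x)
    rw [tmul_mul_right x c x, hconj, tmul_mul_right (x⁻¹ * a * x) (x⁻¹ * c * x) x, hx] at h1
    have h2 := tmul_mul_right (a * x) c x
    rw [tmul_mul_left a x x, hconj, tmul_mul_left (x⁻¹ * a * x) x (x⁻¹ * c * x), hx] at h2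
    have cancel : ∀ A U X V : TensorSquare G, A * U * (X * V) = A * X * (U * V) →
        U * X = X * U := fun A U X V h => by
      have h' : A * (U * X) * V = A * (X * U) * V := by simpa only [mul_assoc] using h
      exact mul_left_cancel (mul_right_cancel h')
    exact cancel _ _ _ _ (h1.symm.trans h2)
  rw [Subgroup.mem_center_iff]
  intro g
  have hg : g ∈ Subgroup.closure (Set.range (PresentedGroup.of (rels := {r | TensorRel G r}))) := by
    rw [PresentedGroup.closure_range_of]; trivial
  induction hg using Subgroup.closure_induction with
  | mem g hg => obtain ⟨⟨u, v⟩, rfl⟩ := hg; exact key u v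
  | one => simp
  | mul a b _ _ ha hb => rw [mul_assoc, hb, ← mul_assoc, ha, mul_assoc]
  | inv a _ ha => exact (Commute.inv_left (show Commute a _ from ha)).eq

end Abstract

/-! ### The complete nonabelian tensor and exterior squares -/

section Complete

variable (p : ℕ) (G : Type*) [Group G] [TopologicalSpace G]

/-- The kernels of the finite `p`-quotients of `G ⊗ G` in which the symbol `x ⊗ y` depends
continuously on `(x, y) ∈ G × G` (each quotient of `G ⊗ G` is discrete). -/
def ContinuousPKernel : Type _ :=
  {K : Subgroup (TensorSquare G) // K.Normal ∧ (∃ k : ℕ, K.index = p ^ k) ∧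
    Continuous fun z : G × G => (QuotientGroup.mk (tmul z.1 z.2) : TensorSquare G ⧸ K)}

instance (K : ContinuousPKernel p G) : K.1.Normal := K.2.1

/-- The canonical homomorphism of `G ⊗ G` to the product of these finite `p`-groups. -/
def toProduct : TensorSquare G →* ((K : ContinuousPKernel p G) → TensorSquare G ⧸ K.1) :=
  MonoidHom.pi fun K => QuotientGroup.mk' K.1

/-- The complete nonabelian tensor square `G ⊗̂ G`: the pro-`p`-group topologically generated by
symbols `x ⊗̂ y`, continuous in `(x, y)`, subject to the two tensor relations. It is
the inverse limit of the finite `p`-quotients of `G ⊗ G` with continuous symbols, realised as the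
closure of the image of `G ⊗ G` in their product (product topology, discrete factors). -/
abbrev CompleteTensorSquare : Type _ := (toProduct p G).range.topologicalClosure

variable {G}

/-- The symbol `x ⊗̂ y`. -/
def ctmul (x y : G) : CompleteTensorSquare p G :=
  ⟨toProduct p G (tmul x y), Subgroup.le_topologicalClosure _ ⟨_, rfl⟩⟩

theorem ctmul_self_mem_center (x : G) :
    ctmul p x x ∈ Subgroup.center (CompleteTensorSquare p G) := by
  rw [Subgroup.mem_center_iff]
  rintro ⟨g, hg⟩
  apply Subtype.ext
  have hclosed : IsClosed {g : (K : ContinuousPKernel p G) → TensorSquare G ⧸ K.1 |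
      g * toProduct p G (tmul x x) = toProduct p G (tmul x x) * g} :=
    isClosed_eq (by fun_prop) (by fun_prop)
  refine closure_minimal ?_ hclosed hg
  rintro _ ⟨t, rfl⟩
  change toProduct p G t * _ = _ * toProduct p G t
  rw [← map_mul, ← map_mul, Subgroup.mem_center_iff.1 (tmul_self_mem_center x) t]

variable (G)

/-- `∇̂(G)`: the closed subgroup of `G ⊗̂ G` topologically generated by the `x ⊗̂ x`. -/
def nabla : Subgroup (CompleteTensorSquare p G) :=
  (Subgroup.closure (Set.range fun x : G => ctmul p x x)).topologicalClosure

instance : (nabla p G).Normal := by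
  have h : Subgroup.closure (Set.range fun x : G => ctmul p x x) ≤
      Subgroup.center (CompleteTensorSquare p G) := by
    rw [Subgroup.closure_le]
    rintro _ ⟨x, rfl⟩
    exact ctmul_self_mem_center p x
  have : (Subgroup.closure (Set.range fun x : G => ctmul p x x)).Normal :=
    ⟨fun n hn g => by
      rw [Subgroup.mem_center_iff.1 (h hn) g, mul_inv_cancel_right]; exact hn⟩
  exact Subgroup.is_normal_topologicalClosure _

/-- The complete nonabelian exterior square `G ∧̂ G = (G ⊗̂ G) / ∇̂(G)`. -/
abbrev CompleteExteriorSquare : Type _ := CompleteTensorSquare p G ⧸ nabla p G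

variable {G}

/-- The symbol `x ∧̂ y`. -/
def wedge (x y : G) : CompleteExteriorSquare p G := QuotientGroup.mk (ctmul p x y)

variable (G)

/-- The complete exterior center `Ẑ(G) = {g | g ∧̂ y = 1 for all y}`. -/
def completeExteriorCenter : Set G := {g | ∀ y : G, wedge p g y = 1}

/-- `C = {(x, y) ∈ G × G | x ∧̂ y = 1}`. -/
def wedgeTrivialPairs : Set (G × G) := {z | wedge p z.1 z.2 = 1}

end Complete

/-! ### Haar measure and the exterior degree -/

/-- The normalized Haar measure of a compact group, on its Borel `σ`-algebra. -/
def normalizedHaar (G : Type*) [Group G] [TopologicalSpace G] [IsTopologicalGroup G]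
    [CompactSpace G] : @Measure G (borel G) :=
  letI : MeasurableSpace G := borel G
  haveI : BorelSpace G := ⟨rfl⟩
  Measure.haarMeasure (⊤ : TopologicalSpace.PositiveCompacts G)

/-- The exterior degree `d̂(G) = (μ × μ)(C)`. Here `μ × μ` is the normalized Haar
measure of the compact group `G × G`, defined on all Borel sets of `G × G`; the closed set `C` need
not lie in the product of the Borel `σ`-algebras when `G` is not second countable. -/
def exteriorDegree (p : ℕ) (G : Type*) [Group G] [TopologicalSpace G] [IsTopologicalGroup G]
    [CompactSpace G] : ℝ :=
  (normalizedHaar (G × G) (wedgeTrivialPairs p G)).toReal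

end

end ProPExterior

/-! The projection `G → G/N` induces a map of complete exterior squares sending symbols to symbols,
so a pair with trivial wedge in `G` has trivial wedge in `G/N`. The projection of `G × G` carries
Haar measure to Haar measure (`normalizedHaar_preimage`), so both degrees are measures of subsets of
`G × G`, one contained in the other. This gives the inequality.

If `N` lies in the complete exterior center, the two sets coincide because the induced map is
injective (`completeExteriorMap_injective`). The reason is seen at finite level. By `mem_nabla_iff`,
an element of the exterior square is detected by the finite quotients of `G ⊗ G` in which all `x ⊗
x` die. In such a quotient every `n ⊗ y` with `n ∈ N` dies too, hence by antisymmetry every `y ⊗ n`,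
and the quotient factors through `G/N ⊗ G/N` (`ker_tensorMap_le`). So it is already a finite
quotient for `G/N`. Compactness upgrades the continuous bijection to a topological isomorphism. -/

namespace ProPExterior

noncomputable section

/-! ### Maps out of the abstract tensor square -/

section Lift

variable {G H A : Type*} [Group G] [Group H] [Group A]

/-- The universal property of the nonabelian tensor square. -/
def tensorLift (φ : G → G → A)
    (left : ∀ x y z, φ (x * y) z = φ (y⁻¹ * x * y) (y⁻¹ * z * y) * φ y z)
    (right : ∀ y t z, φ y (t * z) = φ y z * φ (z⁻¹ * y * z) (z⁻¹ * t * z)) :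
    TensorSquare G →* A :=
  PresentedGroup.toGroup (f := fun z : G × G => φ z.1 z.2) (by
    rintro _ (⟨x, y, z⟩ | ⟨y, t, z⟩)
    · simp only [map_mul, map_inv, FreeGroup.lift_apply_of]
      rw [mul_inv_eq_one, left]
    · simp only [map_mul, map_inv, FreeGroup.lift_apply_of]
      rw [mul_inv_eq_one, right])

@[simp]
theorem tensorLift_tmul (φ : G → G → A) (left right) (x y : G) :
    tensorLift φ left right (tmul x y) = φ x y :=
  PresentedGroup.toGroup.of _

theorem tensorSquare_hom_ext {g h : TensorSquare G →* A}
    (H : ∀ x y, g (tmul x y) = h (tmul x y)) : g = h :=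
  PresentedGroup.ext fun z => H z.1 z.2

/-- The functoriality of the nonabelian tensor square. -/
def tensorMap (f : G →* H) : TensorSquare G →* TensorSquare H :=
  tensorLift (fun x y => tmul (f x) (f y))
    (fun x y z => by simp only [map_mul, map_inv, tmul_mul_left (f x)])
    (fun y t z => by simp only [map_mul, map_inv, tmul_mul_right (f y)])

@[simp]
theorem tensorMap_tmul (f : G →* H) (x y : G) :
    tensorMap f (tmul x y) = tmul (f x) (f y) :=
  tensorLift_tmul _ _ _ _ _

theorem tensorMap_surjective {f : G →* H} (hf : Function.Surjective f) :
    Function.Surjective (tensorMap f) := by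
  rw [← MonoidHom.range_eq_top, ← top_le_iff,
    ← PresentedGroup.closure_range_of, Subgroup.closure_le]
  rintro _ ⟨⟨a, b⟩, rfl⟩
  obtain ⟨x, rfl⟩ := hf a
  obtain ⟨y, rfl⟩ := hf b
  exact ⟨tmul x y, tensorMap_tmul f x y⟩

/-- Modulo the diagonal symbols, the symbols are antisymmetric. -/
theorem hom_tmul_mul_tmul_swap (g : TensorSquare G →* A) (hg : ∀ x, g (tmul x x) = 1) (x y : G) :
    g (tmul x y) * g (tmul y x) = 1 := by
  -- With `x = a^y`, expanding `ay ⊗ ay` in both variables gives `(x ⊗ y)(x^y ⊗ x^y)(y ⊗ y)(y ⊗ x)`,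
  -- whose two middle factors are diagonal.
  obtain ⟨a, rfl⟩ : ∃ a, x = y⁻¹ * a * y := ⟨y * x * y⁻¹, by group⟩
  have e : y⁻¹ * (a * y) * y = (y⁻¹ * a * y) * y := by group
  have h := hg (a * y)
  rw [tmul_mul_left a y (a * y), tmul_mul_right y a y, e,
    tmul_mul_right (y⁻¹ * a * y) (y⁻¹ * a * y) y] at h
  have hy : y⁻¹ * y * y = y := by group
  simpa [hg, hy] using h

/-- If `g` kills the diagonal symbols and all `n ⊗ y` with `n ∈ N`, it kills the kernel of
`G ⊗ G → G/N ⊗ G/N`. -/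
theorem ker_tensorMap_le {f : G →* H} (hf : Function.Surjective f) (g : TensorSquare G →* A)
    (hg : ∀ x, g (tmul x x) = 1) (hn : ∀ n ∈ f.ker, ∀ y, g (tmul n y) = 1) :
    (tensorMap f).ker ≤ g.ker := by
  have hn' : ∀ n ∈ f.ker, ∀ y, g (tmul y n) = 1 := fun n h y => by
    simpa [hn n h] using hom_tmul_mul_tmul_swap g hg y n
  have hl : ∀ x x' y, f x = f x' → g (tmul x y) = g (tmul x' y) := fun x x' y h => by
    obtain ⟨n, rfl⟩ : ∃ n, x = n * x' := ⟨x * x'⁻¹, by group⟩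
    have hk : n ∈ f.ker := by simpa [MonoidHom.mem_ker] using h
    have hk' : x'⁻¹ * n * x' ∈ f.ker := by
      simpa using (inferInstance : f.ker.Normal).conj_mem n hk x'⁻¹
    rw [tmul_mul_left, map_mul, hn _ hk', one_mul]
  have hr : ∀ x y y', f y = f y' → g (tmul x y) = g (tmul x y') := fun x y y' h => by
    obtain ⟨n, rfl⟩ : ∃ n, y = n * y' := ⟨y * y'⁻¹, by group⟩
    have hk : n ∈ f.ker := by simpa [MonoidHom.mem_ker] using h
    have hk' : y'⁻¹ * n * y' ∈ f.ker := by
      simpa using (inferInstance : f.ker.Normal).conj_mem n hk y'⁻¹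
    rw [tmul_mul_right, map_mul, hn' _ hk', mul_one]
  have hlr : ∀ x x' y y', f x = f x' → f y = f y' → g (tmul x y) = g (tmul x' y') :=
    fun x x' y y' h h' => (hl x x' y h).trans (hr x' y y' h')
  -- Since `g (x ⊗ y)` depends only on `f x` and `f y`, a merely set-theoretic section of `f`
  -- suffices to factor `g` through `tensorMap f`.
  let s := Function.surjInv hf
  have hs : ∀ a, f (s a) = a := Function.surjInv_eq hf
  let ψ : TensorSquare H →* A := tensorLift (fun a b => g (tmul (s a) (s b)))
    (fun x y z => by
      rw [hlr (s (x * y)) (s x * s y) (s z) (s z) (by simp [hs]) rfl, tmul_mul_left, map_mul]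
      congr 1
      exact hlr _ _ _ _ (by simp [hs]) (by simp [hs]))
    (fun y t z => by
      rw [hlr (s y) (s y) (s (t * z)) (s t * s z) rfl (by simp [hs]), tmul_mul_right, map_mul]
      congr 1
      exact hlr _ _ _ _ (by simp [hs]) (by simp [hs]))
  have hψ : ψ.comp (tensorMap f) = g := tensorSquare_hom_ext fun x y => by
    simp only [MonoidHom.comp_apply, tensorMap_tmul, ψ, tensorLift_tmul]
    exact hlr _ _ _ _ (hs _) (hs _)
  intro t ht
  rw [MonoidHom.mem_ker] at ht ⊢
  rw [← hψ, MonoidHom.comp_apply, ht, map_one]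

end Lift

/-! ### Kernels of finite quotients with continuous symbols -/

section Kernels

variable {p : ℕ} {G : Type*} [Group G] [TopologicalSpace G]
  {H : Type*} [Group H] [TopologicalSpace H]

instance (K : Subgroup (TensorSquare G)) : DiscreteTopology (TensorSquare G ⧸ K) :=
  QuotientGroup.discreteTopology (isOpen_discrete _)

/-- Into a discrete quotient, continuity is local constancy. In this form the condition visibly
passes to larger subgroups and to finite intersections. -/
theorem continuous_mk_tmul_iff (K : Subgroup (TensorSquare G)) :
    Continuous (fun z : G × G => (QuotientGroup.mk (tmul z.1 z.2) : TensorSquare G ⧸ K)) ↔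
      ∀ z : G × G, ∀ᶠ z' in 𝓝 z, (tmul z.1 z.2)⁻¹ * tmul z'.1 z'.2 ∈ K := by
  rw [continuous_iff_continuousAt]
  refine forall_congr' fun z => ?_
  rw [ContinuousAt, nhds_discrete (TensorSquare G ⧸ K), Filter.tendsto_pure]
  refine Filter.eventually_congr (Filter.Eventually.of_forall fun z' => ?_)
  rw [eq_comm, QuotientGroup.eq]

/-- Larger normal subgroups of the tensor square inherit finite `p`-index and continuity. -/
def ContinuousPKernel.ofLE [Fact p.Prime] (K : ContinuousPKernel p G)
    (L : Subgroup (TensorSquare G)) (hL : L.Normal) (h : K.1 ≤ L) : ContinuousPKernel p G :=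
  ⟨L, hL, by
    obtain ⟨k, hk⟩ := K.2.2.1
    obtain ⟨l, -, hl⟩ := (Nat.dvd_prime_pow Fact.out).1 (hk ▸ Subgroup.index_dvd_of_le h)
    exact ⟨l, hl⟩,
    (continuous_mk_tmul_iff L).2 fun z =>
      ((continuous_mk_tmul_iff K.1).1 K.2.2.2 z).mono fun _ hz => h hz⟩

/-- The kernels are directed downwards, as the index of an intersection divides the product of the
indices. Hence finitely many coordinates are controlled by a single finite quotient. -/
theorem ContinuousPKernel.exists_le_finset [Fact p.Prime] (I : Finset (ContinuousPKernel p G)) :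
    ∃ K : ContinuousPKernel p G, ∀ L ∈ I, K.1 ≤ L.1 := by
  classical
  induction I using Finset.induction_on with
  | empty =>
    refine ⟨⟨⊤, inferInstance, ⟨0, by simp⟩, ?_⟩, by simp⟩
    rw [continuous_mk_tmul_iff]
    simp
  | insert L I _ ih =>
    obtain ⟨K, hK⟩ := ih
    refine ⟨⟨K.1 ⊓ L.1, inferInstance, ?_, ?_⟩, ?_⟩
    · obtain ⟨k, hk⟩ := K.2.2.1
      obtain ⟨l, hl⟩ := L.2.2.1
      have h : (K.1 ⊓ L.1).index ∣ p ^ (k + l) := by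
        rw [← Subgroup.relIndex_mul_index (inf_le_right : K.1 ⊓ L.1 ≤ L.1),
          Subgroup.inf_relIndex_right, pow_add, ← hk, ← hl]
        exact Nat.mul_dvd_mul (Subgroup.relIndex_dvd_index_of_normal _ _) dvd_rfl
      obtain ⟨m, -, hm⟩ := (Nat.dvd_prime_pow Fact.out).1 h
      exact ⟨m, hm⟩
    · rw [continuous_mk_tmul_iff]
      intro z
      filter_upwards [(continuous_mk_tmul_iff K.1).1 K.2.2.2 z,
        (continuous_mk_tmul_iff L.1).1 L.2.2.2 z] with z' h h'
      exact ⟨h, h'⟩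
    · intro M hM
      rcases Finset.mem_insert.1 hM with rfl | hM
      · exact inf_le_right
      · exact inf_le_left.trans (hK M hM)

/-- Pulling back along a continuous surjective homomorphism. -/
def ContinuousPKernel.comap {f : G →* H} (hc : Continuous f) (hf : Function.Surjective f)
    (K : ContinuousPKernel p H) : ContinuousPKernel p G :=
  ⟨K.1.comap (tensorMap f), inferInstance, by
    rw [Subgroup.index_comap_of_surjective _ (tensorMap_surjective hf)]
    exact K.2.2.1, by
    rw [continuous_mk_tmul_iff]
    intro z
    have h := (continuous_mk_tmul_iff K.1).1 K.2.2.2 (f z.1, f z.2)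
    have hcz : Filter.Tendsto (fun z : G × G => (f z.1, f z.2)) (𝓝 z) (𝓝 (f z.1, f z.2)) :=
      Continuous.tendsto (by fun_prop) z
    filter_upwards [hcz.eventually h] with z' hz'
    simpa [Subgroup.mem_comap] using hz'⟩

/-- Pushing forward along an open quotient homomorphism, for subgroups containing the kernel. -/
def ContinuousPKernel.map {f : G →* H} (hf : IsOpenQuotientMap f)
    (K : ContinuousPKernel p G) (hK : (tensorMap f).ker ≤ K.1) : ContinuousPKernel p H :=
  ⟨K.1.map (tensorMap f), K.2.1.map _ (tensorMap_surjective hf.surjective), by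
    rw [Subgroup.index_map_eq _ (tensorMap_surjective hf.surjective) hK]
    exact K.2.2.1, by
    have : (K.1.map (tensorMap f)).Normal := K.2.1.map _ (tensorMap_surjective hf.surjective)
    -- `f × f` is again a quotient map because `f` is open, so continuity may be tested on `G × G`.
    rw [← (hf.prodMap hf).continuous_comp_iff]
    have h : Continuous (QuotientGroup.map K.1 (K.1.map (tensorMap f)) (tensorMap f)
      (Subgroup.le_comap_map _ _)) := continuous_of_discreteTopology
    refine (h.comp K.2.2.2).congr fun z => ?_
    simp only [Function.comp_apply, QuotientGroup.map_mk, tensorMap_tmul, Prod.map]⟩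

end Kernels

/-! ### Topology of the complete squares -/

section Topology

variable {p : ℕ} {G : Type*} [Group G] [TopologicalSpace G]

theorem finite_quotient_continuousPKernel [Fact p.Prime] (K : ContinuousPKernel p G) :
    Finite (TensorSquare G ⧸ K.1) := by
  have : K.1.FiniteIndex := ⟨by
    obtain ⟨k, hk⟩ := K.2.2.1
    rw [hk]
    exact pow_ne_zero _ (Fact.out : p.Prime).ne_zero⟩
  infer_instance

instance [Fact p.Prime] : CompactSpace (CompleteTensorSquare p G) := by
  have : ∀ K : ContinuousPKernel p G, Finite (TensorSquare G ⧸ K.1) :=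
    finite_quotient_continuousPKernel
  exact isCompact_iff_compactSpace.1
    (Subgroup.isClosed_topologicalClosure (toProduct p G).range).isCompact

theorem isClosed_nabla : IsClosed (nabla p G : Set (CompleteTensorSquare p G)) :=
  Subgroup.isClosed_topologicalClosure _

theorem continuous_ctmul : Continuous fun z : G × G => ctmul p z.1 z.2 :=
  Continuous.subtype_mk (continuous_pi fun K => K.2.2.2) _

theorem wedge_eq_one_iff (x y : G) : wedge p x y = 1 ↔ ctmul p x y ∈ nabla p G :=
  QuotientGroup.eq_one_iff _

/-- Closedness makes the set Borel, as needed to transport its Haar measure along quotient maps. -/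
theorem isClosed_wedgeTrivialPairs : IsClosed (wedgeTrivialPairs p G) := by
  have : wedgeTrivialPairs p G = (fun z : G × G => ctmul p z.1 z.2) ⁻¹' nabla p G :=
    Set.ext fun z => wedge_eq_one_iff z.1 z.2
  rw [this]
  exact isClosed_nabla.preimage continuous_ctmul

/-- The projection of `G ⊗̂ G` to one of its finite quotients. -/
def coordinate (K : ContinuousPKernel p G) : CompleteTensorSquare p G →* TensorSquare G ⧸ K.1 :=
  (Pi.evalMonoidHom (fun K : ContinuousPKernel p G => TensorSquare G ⧸ K.1) K).comp
    (toProduct p G).range.topologicalClosure.subtype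

theorem continuous_coordinate (K : ContinuousPKernel p G) : Continuous (coordinate K) :=
  (continuous_apply K).comp continuous_subtype_val

variable (p G) in
/-- The canonical homomorphism `G ⊗ G → G ⊗̂ G`. -/
def toComplete : TensorSquare G →* CompleteTensorSquare p G :=
  (toProduct p G).codRestrict _ fun t => Subgroup.le_topologicalClosure _ ⟨t, rfl⟩

/-- Elements of the complete tensor square agree with elements of the abstract tensor square at any
finitely many coordinates. -/
theorem exists_coordinate_eq (w : CompleteTensorSquare p G) (I : Finset (ContinuousPKernel p G)) :
    ∃ t : TensorSquare G, ∀ K ∈ I, coordinate K w = QuotientGroup.mk t := by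
  have hO : IsOpen ((I : Set (ContinuousPKernel p G)).pi
      fun K => ({coordinate K w} : Set (TensorSquare G ⧸ K.1))) :=
    isOpen_set_pi I.finite_toSet fun _ _ => isOpen_discrete _
  obtain ⟨_, hv, ⟨t, rfl⟩⟩ := mem_closure_iff.1 w.2 _ hO fun K _ => rfl
  exact ⟨t, fun K hK => (hv K hK).symm⟩

/-- The sets of elements with prescribed coordinates at finitely many places form a base. -/
theorem exists_finset_subset {O : Set (CompleteTensorSquare p G)} (hO : IsOpen O)
    {w : CompleteTensorSquare p G} (hw : w ∈ O) :
    ∃ I : Finset (ContinuousPKernel p G),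
      ∀ v, (∀ K ∈ I, coordinate K v = coordinate K w) → v ∈ O := by
  obtain ⟨O', hO', rfl⟩ := isOpen_induced_iff.1 hO
  obtain ⟨I, u, hu, hsub⟩ := isOpen_pi_iff.1 hO' w.1 hw
  refine ⟨I, fun v hv => hsub fun K hK => ?_⟩
  have h : v.1 K = w.1 K := hv K hK
  rw [h]
  exact (hu K hK).2

/-- `∇̂(G)` is cut out by the finite quotients in which all symbols `x ⊗ x` are trivial. -/
theorem mem_nabla_iff [Fact p.Prime] (w : CompleteTensorSquare p G) :
    w ∈ nabla p G ↔
      ∀ K : ContinuousPKernel p G, (∀ x, tmul x x ∈ K.1) → coordinate K w = 1 := by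
  classical
  constructor
  · intro hw K hK
    have hcl : IsClosed ((coordinate K).ker : Set (CompleteTensorSquare p G)) :=
      (isClosed_discrete {(1 : TensorSquare G ⧸ K.1)}).preimage (continuous_coordinate K)
    have hle : nabla p G ≤ (coordinate K).ker := by
      refine Subgroup.topologicalClosure_minimal _ ?_ hcl
      rw [Subgroup.closure_le]
      rintro _ ⟨x, rfl⟩
      exact (QuotientGroup.eq_one_iff _).2 (hK x)
    exact hle hw
  · intro h
    change w ∈ closure _
    rw [mem_closure_iff]
    intro O hO hwO
    obtain ⟨I, hI⟩ := exists_finset_subset hO hwO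
    obtain ⟨K, hK⟩ := ContinuousPKernel.exists_le_finset I
    -- `D` is the abstract diagonal subgroup. The quotient by `K ⊔ D` kills all `x ⊗ x`, so the
    -- hypothesis applies to it.
    let D : Subgroup (TensorSquare G) := Subgroup.closure (Set.range fun x : G => tmul x x)
    have hDc : D ≤ Subgroup.center _ := by
      rw [Subgroup.closure_le]
      rintro _ ⟨x, rfl⟩
      exact tmul_self_mem_center x
    have hD : D.Normal := ⟨fun n hn g => by
      rwa [Subgroup.mem_center_iff.1 (hDc hn) g, mul_inv_cancel_right]⟩
    have hKD : (K.1 ⊔ D).Normal := inferInstance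
    let L := K.ofLE (K.1 ⊔ D) hKD le_sup_left
    obtain ⟨t, ht⟩ := exists_coordinate_eq w (insert L I)
    have hDL : ∀ x, tmul x x ∈ L.1 := fun x =>
      (le_sup_right : D ≤ K.1 ⊔ D) (Subgroup.subset_closure ⟨x, rfl⟩)
    have htL : t ∈ L.1 := (QuotientGroup.eq_one_iff (N := L.1) t).1 <|
      (ht L (Finset.mem_insert_self _ _)).symm.trans (h L hDL)
    -- The factor `k` is invisible at every index in `I`, so `d ∈ D` alone approximates `w` there.
    obtain ⟨k, hk, d, hd, rfl⟩ := Subgroup.mem_sup_of_normal_right.1 (show t ∈ K.1 ⊔ D from htL)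
    refine ⟨toComplete p G d, hI _ fun M hM => ?_, ?_⟩
    · have hkd : d⁻¹ * (k * d) ∈ M.1 := by
        simpa [mul_assoc] using M.2.1.conj_mem k (hK M hM hk) d⁻¹
      exact (QuotientGroup.eq.2 hkd).trans (ht M (Finset.mem_insert_of_mem hM)).symm
    · have hle : D ≤ (Subgroup.closure (Set.range fun x : G => ctmul p x x)).comap
          (toComplete p G) := by
        rw [Subgroup.closure_le]
        rintro _ ⟨x, rfl⟩
        exact Subgroup.subset_closure ⟨x, rfl⟩
      exact hle hd

end Topology

/-! ### Functoriality of the complete squares -/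

section Functoriality

variable {p : ℕ} {G : Type*} [Group G] [TopologicalSpace G]
  {H : Type*} [Group H] [TopologicalSpace H]

/-- The homomorphism between the products of finite `p`-groups induced by `f : G → H`. -/
def productMap {f : G →* H} (hc : Continuous f) (hf : Function.Surjective f) :
    ((K : ContinuousPKernel p G) → TensorSquare G ⧸ K.1) →*
      ((K : ContinuousPKernel p H) → TensorSquare H ⧸ K.1) :=
  MonoidHom.pi fun K => (QuotientGroup.map (K.comap hc hf).1 K.1 (tensorMap f) le_rfl).comp
    (Pi.evalMonoidHom _ (K.comap hc hf))

theorem continuous_productMap {f : G →* H} (hc : Continuous f) (hf : Function.Surjective f) :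
    Continuous (productMap (p := p) hc hf) :=
  continuous_pi fun K =>
    (continuous_of_discreteTopology
      (f := QuotientGroup.map (K.comap hc hf).1 K.1 (tensorMap f) le_rfl)).comp
      (continuous_apply (K.comap hc hf))

theorem productMap_toProduct {f : G →* H} (hc : Continuous f) (hf : Function.Surjective f)
    (t : TensorSquare G) :
    productMap (p := p) hc hf (toProduct p G t) = toProduct p H (tensorMap f t) :=
  rfl

theorem productMap_mem {f : G →* H} (hc : Continuous f) (hf : Function.Surjective f)
    {w : (K : ContinuousPKernel p G) → TensorSquare G ⧸ K.1}
    (hw : w ∈ (toProduct p G).range.topologicalClosure) :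
    productMap hc hf w ∈ (toProduct p H).range.topologicalClosure := by
  have hmaps : Set.MapsTo (productMap (p := p) hc hf) (toProduct p G).range
      (toProduct p H).range := by
    rintro _ ⟨t, rfl⟩
    exact ⟨tensorMap f t, (productMap_toProduct hc hf t).symm⟩
  exact map_mem_closure (continuous_productMap hc hf) hw hmaps

/-- The homomorphism `G ⊗̂ G → H ⊗̂ H` induced by a continuous surjection `G → H`. -/
def completeTensorMap {f : G →* H} (hc : Continuous f) (hf : Function.Surjective f) :
    CompleteTensorSquare p G →* CompleteTensorSquare p H :=
  ((productMap hc hf).comp (toProduct p G).range.topologicalClosure.subtype).codRestrict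
    (toProduct p H).range.topologicalClosure fun w =>
      productMap_mem hc hf w.2

theorem coordinate_completeTensorMap {f : G →* H} (hc : Continuous f)
    (hf : Function.Surjective f) (K : ContinuousPKernel p H) (w : CompleteTensorSquare p G) :
    coordinate K (completeTensorMap hc hf w) =
      QuotientGroup.map (K.comap hc hf).1 K.1 (tensorMap f) le_rfl
        (coordinate (K.comap hc hf) w) :=
  rfl

theorem continuous_completeTensorMap {f : G →* H} (hc : Continuous f)
    (hf : Function.Surjective f) : Continuous (completeTensorMap (p := p) hc hf) :=
  ((continuous_productMap hc hf).comp continuous_subtype_val).subtype_mk _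

theorem completeTensorMap_ctmul {f : G →* H} (hc : Continuous f) (hf : Function.Surjective f)
    (x y : G) : completeTensorMap hc hf (ctmul p x y) = ctmul p (f x) (f y) :=
  Subtype.ext <| (productMap_toProduct hc hf _).trans <| by rw [tensorMap_tmul]; rfl

/-- The image is compact, hence closed, and it contains the dense image of `H ⊗ H`. -/
theorem completeTensorMap_surjective [Fact p.Prime] {f : G →* H} (hc : Continuous f)
    (hf : Function.Surjective f) :
    Function.Surjective (completeTensorMap (p := p) hc hf) := by
  have hcl : IsClosed (Subtype.val '' Set.range (completeTensorMap (p := p) hc hf)) :=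
    ((isCompact_range (continuous_completeTensorMap hc hf)).image
      continuous_subtype_val).isClosed
  intro v
  have hv := closure_minimal (t := Subtype.val '' Set.range (completeTensorMap (p := p) hc hf))
    (s := ((toProduct p H).range : Set _)) (by
      rintro _ ⟨s, rfl⟩
      obtain ⟨t, rfl⟩ := tensorMap_surjective hf s
      exact ⟨_, ⟨⟨toProduct p G t, Subgroup.le_topologicalClosure _ ⟨t, rfl⟩⟩, rfl⟩, rfl⟩) hcl v.2
  obtain ⟨_, ⟨w, rfl⟩, hw⟩ := hv
  exact ⟨w, Subtype.ext hw⟩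

theorem nabla_le_comap {f : G →* H} (hc : Continuous f) (hf : Function.Surjective f) :
    nabla p G ≤ (nabla p H).comap (completeTensorMap hc hf) := by
  refine Subgroup.topologicalClosure_minimal _ ?_
    (isClosed_nabla.preimage (continuous_completeTensorMap hc hf))
  rw [Subgroup.closure_le]
  rintro _ ⟨x, rfl⟩
  change completeTensorMap hc hf (ctmul p x x) ∈ nabla p H
  rw [completeTensorMap_ctmul]
  exact Subgroup.le_topologicalClosure _ (Subgroup.subset_closure ⟨f x, rfl⟩)

/-- The homomorphism `G ∧̂ G → H ∧̂ H` induced by a continuous surjection `G → H`. -/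
def completeExteriorMap {f : G →* H} (hc : Continuous f) (hf : Function.Surjective f) :
    CompleteExteriorSquare p G →* CompleteExteriorSquare p H :=
  QuotientGroup.map _ _ (completeTensorMap hc hf) (nabla_le_comap hc hf)

theorem completeExteriorMap_wedge {f : G →* H} (hc : Continuous f) (hf : Function.Surjective f)
    (x y : G) : completeExteriorMap hc hf (wedge p x y) = wedge p (f x) (f y) :=
  congrArg QuotientGroup.mk (completeTensorMap_ctmul hc hf x y)

theorem continuous_completeExteriorMap {f : G →* H} (hc : Continuous f)
    (hf : Function.Surjective f) : Continuous (completeExteriorMap (p := p) hc hf) :=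
  (QuotientGroup.continuous_mk.comp (continuous_completeTensorMap hc hf)).quotient_lift _

theorem completeExteriorMap_surjective [Fact p.Prime] {f : G →* H} (hc : Continuous f)
    (hf : Function.Surjective f) : Function.Surjective (completeExteriorMap (p := p) hc hf) :=
  QuotientGroup.map_surjective_of_surjective _ _ _
    (QuotientGroup.mk_surjective.comp (completeTensorMap_surjective hc hf)) _

/-- If the kernel of `f` lies in the complete exterior center, no information is lost. -/
theorem completeExteriorMap_injective [Fact p.Prime] {f : G →* H} (hf : IsOpenQuotientMap f)
    (hker : (f.ker : Set G) ⊆ completeExteriorCenter p G) :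
    Function.Injective (completeExteriorMap (p := p) hf.continuous hf.surjective) := by
  classical
  rw [injective_iff_map_eq_one]
  intro a
  obtain ⟨w, rfl⟩ := QuotientGroup.mk_surjective a
  intro hw
  replace hw : completeTensorMap hf.continuous hf.surjective w ∈ nabla p H :=
    (QuotientGroup.eq_one_iff _).1 hw
  rw [QuotientGroup.eq_one_iff, mem_nabla_iff]
  rw [mem_nabla_iff] at hw
  intro L hL
  have hle : (tensorMap f).ker ≤ L.1 := by
    have := ker_tensorMap_le hf.surjective (QuotientGroup.mk' L.1)
      (fun x => (QuotientGroup.eq_one_iff _).2 (hL x))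
      (fun n hn y => (mem_nabla_iff _).1 ((wedge_eq_one_iff n y).1 (hker hn y)) L hL)
    rwa [QuotientGroup.ker_mk'] at this
  let M := L.map hf hle
  -- `L` and the pullback of `M` are the same subgroup by `hle`; one representative `t` for both
  -- indices avoids transport along this equality.
  obtain ⟨t, ht⟩ := exists_coordinate_eq w {L, M.comap hf.continuous hf.surjective}
  have h1 := hw M fun a => by
    obtain ⟨x, rfl⟩ := hf.surjective a
    exact ⟨tmul x x, hL x, tensorMap_tmul f x x⟩
  rw [coordinate_completeTensorMap, ht _ (by simp)] at h1
  have h2 : t ∈ (L.1.map (tensorMap f)).comap (tensorMap f) :=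
    (QuotientGroup.eq_one_iff (N := M.1) (tensorMap f t)).1 h1
  rw [Subgroup.comap_map_eq_self hle] at h2
  exact (ht L (by simp)).trans ((QuotientGroup.eq_one_iff _).2 h2)

/-- The isomorphism `G ∧̂ G ≃ H ∧̂ H` for a quotient by a subgroup of the complete exterior
center. -/
def completeExteriorEquiv [Fact p.Prime] {f : G →* H} (hf : IsOpenQuotientMap f)
    (hker : (f.ker : Set G) ⊆ completeExteriorCenter p G) :
    CompleteExteriorSquare p G ≃ₜ* CompleteExteriorSquare p H :=
  -- Closedness makes the target Hausdorff, so the inverse of the continuous bijection from a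
  -- compact space is continuous.
  haveI : IsClosed (nabla p H : Set (CompleteTensorSquare p H)) := isClosed_nabla
  let e : CompleteExteriorSquare p G ≃* CompleteExteriorSquare p H :=
    MulEquiv.ofBijective (completeExteriorMap hf.continuous hf.surjective)
      ⟨completeExteriorMap_injective hf hker, completeExteriorMap_surjective _ hf.surjective⟩
  have he : Continuous e := continuous_completeExteriorMap hf.continuous hf.surjective
  { e with
    continuous_toFun := he
    continuous_invFun := he.continuous_symm_of_equiv_compact_to_t2 (f := e.toEquiv) }

end Functoriality

/-! ### Haar measure -/

section Haar

variable {G : Type*} [Group G] [TopologicalSpace G] [IsTopologicalGroup G] [CompactSpace G]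
  {H : Type*} [Group H] [TopologicalSpace H] [IsTopologicalGroup H] [CompactSpace H]

/-- A continuous surjective homomorphism of compact groups preserves the normalized Haar measure
of closed sets. -/
theorem normalizedHaar_preimage (f : G →* H) (hc : Continuous f) (hf : Function.Surjective f)
    {s : Set H} (hs : IsClosed s) : normalizedHaar G (f ⁻¹' s) = normalizedHaar H s := by
  let _ : MeasurableSpace G := borel G
  have : BorelSpace G := ⟨rfl⟩
  let _ : MeasurableSpace H := borel H
  have : BorelSpace H := ⟨rfl⟩
  let μ : Measure G := Measure.haarMeasure ⊤
  let ν : Measure H := Measure.haarMeasure ⊤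
  have : IsProbabilityMeasure μ := ⟨Measure.haarMeasure_self (K₀ := ⊤)⟩
  have : IsProbabilityMeasure ν := ⟨Measure.haarMeasure_self (K₀ := ⊤)⟩
  -- The pushforward is a Haar probability measure on `H`, and such a measure is unique.
  have : (μ.map f).IsHaarMeasure := Measure.isHaarMeasure_map_of_isFiniteMeasure μ f hc hf
  have : IsProbabilityMeasure (μ.map f) :=
    Measure.isProbabilityMeasure_map hc.measurable.aemeasurable
  change μ (f ⁻¹' s) = ν s
  rw [← Measure.isHaarMeasure_eq_of_isProbabilityMeasure (μ.map f) ν,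
    Measure.map_apply hc.measurable hs.measurableSet]

/-- The exterior degree of a quotient, as a measure on `G × G`. -/
theorem exteriorDegree_eq_preimage (p : ℕ) (f : G →* H) (hc : Continuous f)
    (hf : Function.Surjective f) : exteriorDegree p H =
      (normalizedHaar (G × G) (Prod.map f f ⁻¹' wedgeTrivialPairs p H)).toReal := by
  rw [exteriorDegree, ← normalizedHaar_preimage (f.prodMap f) (hc.prodMap hc) (hf.prodMap hf)
    isClosed_wedgeTrivialPairs]
  rfl

theorem normalizedHaar_ne_top (s : Set G) : normalizedHaar G s ≠ ⊤ := by
  let _ : MeasurableSpace G := borel G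
  have : BorelSpace G := ⟨rfl⟩
  exact measure_ne_top (Measure.haarMeasure (⊤ : TopologicalSpace.PositiveCompacts G)) s

end Haar

end

end ProPExterior

/-! ### Comparison of the exterior degrees of `G` and `G/N` -/

theorem theorem3p8 (p : ℕ) [Fact p.Prime] (G : Type*) [Group G] [TopologicalSpace G]
    [IsTopologicalGroup G] [CompactSpace G] (hG : ProPExterior.IsProP p G)
    (N : Subgroup G) [N.Normal] (hN : IsClosed (N : Set G)) :
    ProPExterior.exteriorDegree p G ≤ ProPExterior.exteriorDegree p (G ⧸ N) ∧
      ((N : Set G) ⊆ ProPExterior.completeExteriorCenter p G →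
        (∃ φ : ProPExterior.CompleteExteriorSquare p G ≃ₜ*
            ProPExterior.CompleteExteriorSquare p (G ⧸ N),
          ∀ x y : G, φ (ProPExterior.wedge p x y) =
            ProPExterior.wedge p (x : G ⧸ N) (y : G ⧸ N)) ∧
        ProPExterior.exteriorDegree p G = ProPExterior.exteriorDegree p (G ⧸ N)) := by

  have hq : IsOpenQuotientMap (QuotientGroup.mk' N) := QuotientGroup.isOpenQuotientMap_mk
  have hdeg := ProPExterior.exteriorDegree_eq_preimage p (QuotientGroup.mk' N)
    hq.continuous hq.surjective
  refine ⟨?_, fun hNZ => ?_⟩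
  · rw [hdeg]
    refine ENNReal.toReal_mono (ProPExterior.normalizedHaar_ne_top _)
      (MeasureTheory.OuterMeasureClass.measure_mono _ ?_)
    intro z (hz : ProPExterior.wedge p z.1 z.2 = 1)
    change ProPExterior.wedge p (QuotientGroup.mk' N z.1) (QuotientGroup.mk' N z.2) = 1
    rw [← ProPExterior.completeExteriorMap_wedge hq.continuous hq.surjective, hz, map_one]
  · have hker : ((QuotientGroup.mk' N).ker : Set G) ⊆ ProPExterior.completeExteriorCenter p G := by
      rwa [QuotientGroup.ker_mk']
    refine ⟨⟨ProPExterior.completeExteriorEquiv hq hker, fun x y =>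
      ProPExterior.completeExteriorMap_wedge hq.continuous hq.surjective x y⟩, ?_⟩
    rw [hdeg, ProPExterior.exteriorDegree]
    -- By injectivity of the induced map, the two subsets of `G × G` are equal, not just their
    -- measures.
    congr 2
    ext z
    change ProPExterior.wedge p z.1 z.2 = 1 ↔
      ProPExterior.wedge p (QuotientGroup.mk' N z.1) (QuotientGroup.mk' N z.2) = 1
    rw [← ProPExterior.completeExteriorMap_wedge hq.continuous hq.surjective,
      map_eq_one_iff _ (ProPExterior.completeExteriorMap_injective hq hker)]
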